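/- Let $G=(\Gamma,E)$ be a fixed connected undirected graph without loops on a finite set $\Gamma$ of at least two agents, let $N_i$ be the set of neighbors of $i$, and let $\xi>0$. Let $D=\{d=(d_{ij})_{(i,j)\in\Gamma^2}:-\xi\le d_{ij}\le\xi\}$. Given $x\in\mathbb R^\Gamma$ and $d\in D$, agent $i$ measures $y_{ij}=x_j+d_{ij}$ for $j\in N_i$, chooses estimates $\tilde y_{ij}\in[y_{ij}-\xi,y_{ij}+\xi]$, $j\in N_i$, that minimize $\bigl|\sum_{j\in N_i}(\tilde y_{ij}-x_i)\bigr|$, and applies the control $u_i(x,d)=\sum_{j\in N_i}(\tilde y_{ij}-x_i)$ (which does not depend on the choice of the minimizer). Let $d:[0,\infty)\to D$ be continuous and let $x(t)$, $t\ge 0$, be a solution of $\dot x_i(t)=u_i(x(t),d(t))$, $i\in\Gamma$. Let $d^-,d^+\in D$ with $d^-\le d^+$ componentwise, let $Q=\{d\in D:d^-\le d\le d^+\}$, and let $\mu(Q,t_1,t_2)$ be the length of the longest subinterval of $[t_1,t_2]$ during which $d(t)$ remains in $Q$ ($0$ if $d(t)$ is never in $Q$ on $[t_1,t_2]$). Suppose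 that there are finite $M\ge 0$ and $\delta>0$ such that $\mu(Q,t,t+M)>\delta$ for all $t\ge 0$. Then, as $t\to\infty$, $x(t)$ converges to a point $x^*$ of the polyhedron $$P(Q,E)=\Bigl\{x\in\mathbb R^\Gamma:\ -\frac{\sum_{j\in N_i}d^+_{ij}}{|N_i|}-\xi\ \le\ \frac{\sum_{j\in N_i}x_j}{|N_i|}-x_i\ \le\ -\frac{\sum_{j\in N_i}d^-_{ij}}{|N_i|}+\xi\quad\forall i\in\Gamma\Bigr\}$$ of equilibrium points for the disturbances in $Q$; in particular, $x^*$ is an equilibrium point for some constant disturbance $q\in Q$, that is, $u_i(x^*,q)=0$ for all $i\in\Gamma$. -/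

import Mathlib

open Set Filter Topology

namespace Consensus

variable {V : Type*}

/-- The hypercube `D` of admissible disturbance vectors `d = (d i j)`, indexed by all pairs. -/
def cube (V : Type*) (ξ : ℝ) : Set (V → V → ℝ) :=
  {d | ∀ i j, -ξ ≤ d i j ∧ d i j ≤ ξ}

/-- The box `Q = {d ∈ D : dlo ≤ d ≤ dhi}`. -/
def box (ξ : ℝ) (dlo dhi : V → V → ℝ) : Set (V → V → ℝ) :=
  {d | d ∈ cube V ξ ∧ dlo ≤ d ∧ d ≤ dhi}

/-- A disturbance realization: a continuous function of time `t ≥ 0` with values in `D`. -/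
structure IsRealization (ξ : ℝ) (d : ℝ → V → V → ℝ) : Prop where
  continuousOn : ContinuousOn d (Ici 0)
  mem_cube : ∀ t, 0 ≤ t → d t ∈ cube V ξ

/-- `μ(Q, t₁, t₂)`: the length of the longest subinterval of `[t₁, t₂]` on which `d` stays in `Q`.
It is `0` if `d` is never in `Q` on `[t₁, t₂]`. -/
noncomputable def longestStay (d : ℝ → V → V → ℝ) (Q : Set (V → V → ℝ)) (t₁ t₂ : ℝ) : ℝ :=
  sSup {Δ : ℝ | 0 ≤ Δ ∧ ∃ s, t₁ ≤ s ∧ s + Δ ≤ t₂ ∧ ∀ t ∈ Icc s (s + Δ), d t ∈ Q}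

section Network

variable [Fintype V] (G : SimpleGraph V) [DecidableRel G.Adj]

/-- The information vector of agent `i`: the disturbed measures `x j + d i j` of the states of
its neighbors, and `0` in the other components. -/
def information (d : V → V → ℝ) (x : V → ℝ) (i : V) : V → ℝ :=
  fun j => if G.Adj i j then x j + d i j else 0

/-- The estimates of the neighbors' states that are compatible with the measures `y`. -/
def estimates (ξ : ℝ) (i : V) (y : V → ℝ) : Set (V → ℝ) :=
  {z | ∀ j ∈ G.neighborFinset i, z j ∈ Icc (y j - ξ) (y j + ξ)}

/-- The lazy rule: `z` minimizes `|∑ j ∈ N i, (z j - xi)|` among the compatible estimates. -/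
def IsLazyEstimate (ξ : ℝ) (i : V) (xi : ℝ) (y z : V → ℝ) : Prop :=
  z ∈ estimates G ξ i y ∧
    IsMinOn (fun w : V → ℝ => |∑ j ∈ G.neighborFinset i, (w j - xi)|) (estimates G ξ i y) z

/-- `u` is the value of the linear protocol with the lazy rule for agent `i`, in state `xi` and
with information vector `y`. -/
def IsControl (ξ : ℝ) (i : V) (xi : ℝ) (y : V → ℝ) (u : ℝ) : Prop :=
  ∃ z, IsLazyEstimate G ξ i xi y z ∧ u = ∑ j ∈ G.neighborFinset i, (z j - xi)

/-- `x` is a trajectory of the controlled system `ẋ i = u i (x i, y⁽ⁱ⁾)`, `t ≥ 0`, under the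
disturbance realization `d` (with the one-sided derivative at `t = 0`). -/
def IsTrajectory (ξ : ℝ) (d : ℝ → V → V → ℝ) (x : ℝ → V → ℝ) : Prop :=
  ∀ t, 0 ≤ t → ∀ i, ∃ u, IsControl G ξ i (x t i) (information G (d t) (x t) i) u ∧
    HasDerivWithinAt (fun s => x s i) u (Ici 0) t

/-- `p` is an equilibrium point for the disturbance realization `d`: from some time on, the
control vanishes at `p` for all agents. -/
def IsEquilibriumPoint (ξ : ℝ) (d : ℝ → V → V → ℝ) (p : V → ℝ) : Prop :=
  ∃ T, 0 ≤ T ∧ ∀ t, T ≤ t → ∀ i, IsControl G ξ i (p i) (information G (d t) p i) 0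

/-- The polyhedron `P(Q, E)` of the box `Q` with bounds `dlo` and `dhi`. -/
def polyhedron (ξ : ℝ) (dlo dhi : V → V → ℝ) : Set (V → ℝ) :=
  {x | ∀ i,
    -((∑ j ∈ G.neighborFinset i, dhi i j) / (G.degree i : ℝ)) - ξ
        ≤ (∑ j ∈ G.neighborFinset i, x j) / (G.degree i : ℝ) - x i ∧
    (∑ j ∈ G.neighborFinset i, x j) / (G.degree i : ℝ) - x i
        ≤ -((∑ j ∈ G.neighborFinset i, dlo i j) / (G.degree i : ℝ)) + ξ}

end Network

end Consensus

/-!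
The lazy control of agent `i` is the point of least modulus of an interval which contains the total
deviation `L i` of the neighbors' states from that of `i`. By the variational inequality of
projections, the velocity `u` satisfies `u i ^ 2 ≤ u i * L i`: the trajectory follows the heat flow
of the graph, but every agent may be slowed down at will. Hence the Dirichlet energy decreases, at a
rate of at least `2 * |u i| * |L i|` for each `i`, and the sup norm does not increase.

Let `p` be a cluster point of the trajectory. Near `p`, an agent with `L i ≠ 0` at `p` pays with
energy for the distance which it travels, so it hardly moves; the other agents obey a maximum
principle with the former as boundary. The trajectory is therefore trapped near `p`, that is, it
converges to `p`.

The velocities which are feasible at `p` under disturbances in `Q` form a compact convex set. If it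
did not contain `0`, a linear functional of the state would grow at a rate bounded away from zero
during the stays in `Q`, against convergence. Hence `0` is feasible, for some `q` in `Q`.
-/

namespace Consensus

section Analysis

lemma lt_of_forall_Ico_lt {α β : Type*} [ConditionallyCompleteLinearOrder α] [TopologicalSpace α]
    [OrderTopology α] [LinearOrder β] [TopologicalSpace β] [ClosedIciTopology β]
    {f : α → β} {a b : α} {c : β} (hf : ContinuousOn f (Icc a b))
    (h : ∀ t ∈ Icc a b, (∀ r ∈ Ico a t, f r < c) → f t < c) {t : α} (ht : t ∈ Icc a b) :
    f t < c := by
  by_contra! hct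
  have hcompact : IsCompact (Icc a b ∩ f ⁻¹' Ici c) :=
    isCompact_Icc.of_isClosed_subset
      (hf.preimage_isClosed_of_isClosed isClosed_Icc isClosed_Ici) inter_subset_left
  obtain ⟨τ, ⟨hτ, hcτ⟩, hleast⟩ := hcompact.exists_isLeast ⟨t, ht, hct⟩
  refine (h τ hτ fun r hr => ?_).not_ge hcτ
  by_contra! hcr
  exact hr.2.not_ge (hleast ⟨⟨hr.1, hr.2.le.trans hτ.2⟩, hcr⟩)

section MaximumPrinciple

variable {ι : Type*} {f f' : ℝ → ι → ℝ} {a b : ℝ}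

lemma eventually_nonpos_of_deriv_right_neg {g : ℝ → ℝ} {g' : ℝ}
    (hg : HasDerivWithinAt g g' (Ici a) a) (ha : g a ≤ 0) (hneg : g a = 0 → g' < 0) :
    ∀ᶠ t in 𝓝[>] a, g t ≤ 0 := by
  have hg : HasDerivWithinAt g g' (Ioi a) a := hg.mono Ioi_subset_Ici_self
  rcases ha.lt_or_eq with hlt | hzero
  · exact (hg.continuousWithinAt.tendsto.eventually_lt_const hlt).mono fun _ => le_of_lt
  · have hslope := ((hasDerivWithinAt_iff_tendsto_slope' self_notMem_Ioi).1 hg).eventually_lt_const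
      (hneg hzero)
    filter_upwards [hslope, self_mem_nhdsWithin] with t ht hat
    rw [slope_def_field, hzero, sub_zero, div_lt_iff₀ (sub_pos.2 hat), zero_mul] at ht
    exact ht.le

lemma nonpos_of_deriv_right_neg [Finite ι] (hf : ContinuousOn f (Icc a b))
    (hf' : ∀ t ∈ Ico a b, HasDerivWithinAt f (f' t) (Ici t) t) (ha : f a ≤ 0)
    (hneg : ∀ t ∈ Ico a b, f t ≤ 0 → ∀ i, f t i = 0 → f' t i < 0) {t : ℝ} (ht : t ∈ Icc a b) :
    f t ≤ 0 := by
  have := Fintype.ofFinite ι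
  have hclosed : IsClosed ({t | f t ≤ 0} ∩ Icc a b) := by
    rw [inter_comm]
    exact isClosed_Icc.isClosed_le hf continuousOn_const
  refine hclosed.Icc_subset_of_forall_mem_nhdsWithin ha (fun r hr => ?_) ht
  exact eventually_all.2 fun i => eventually_nonpos_of_deriv_right_neg
    (hasDerivWithinAt_pi.1 (hf' r hr.2) i) (hr.1 i) (hneg r hr.2 hr.1 i)

lemma le_of_maximal_deriv_right_nonpos [Finite ι] {m : ℝ} (hf : ContinuousOn f (Icc a b))
    (hf' : ∀ t ∈ Ico a b, HasDerivWithinAt f (f' t) (Ici t) t) (ha : ∀ i, f a i ≤ m)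
    (hmax : ∀ t ∈ Ico a b, ∀ i, m < f t i → (∀ j, f t j ≤ f t i) → f' t i ≤ 0) (hab : a ≤ b)
    (i : ι) : f b i ≤ m := by
  have := Fintype.ofFinite ι
  refine le_of_forall_pos_le_add fun ε hε => ?_
  have hlen : 0 < 1 + b - a := by linarith
  -- Strict inequalities are needed for the comparison, hence the slightly growing barrier.
  let B : ℝ → ℝ := fun t => m + ε / (1 + b - a) * (1 + t - a)
  have hB : ∀ t, a ≤ t → m < B t := fun t ht =>
    lt_add_of_pos_right m (mul_pos (div_pos hε hlen) (by linarith))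
  have hB' : ∀ t, HasDerivAt B (ε / (1 + b - a)) t := fun t =>
    ((((hasDerivAt_id t).const_add 1).sub_const a).const_mul _ |>.const_add m).congr_deriv
      (mul_one _)
  have hbelow : f b - Function.const ι (B b) ≤ 0 := by
    refine nonpos_of_deriv_right_neg (f := fun t => f t - Function.const ι (B t))
      (f' := fun t => f' t - Function.const ι (ε / (1 + b - a))) (hf.sub (by fun_prop))
      (fun t ht => (hf' t ht).sub (hasDerivWithinAt_pi.2 fun _ => (hB' t).hasDerivWithinAt))
      (fun j => sub_nonpos.2 ((ha j).trans (hB a le_rfl).le)) (fun t ht hle j hj => ?_)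
      (right_mem_Icc.2 hab)
    have hfj : f t j = B t := sub_eq_zero.1 hj
    have : f' t j ≤ 0 := hmax t ht j (hfj ▸ hB t ht.1) fun k => hfj ▸ sub_nonpos.1 (hle k)
    exact sub_neg.2 (this.trans_lt (div_pos hε hlen))
  calc f b i ≤ B b := sub_nonpos.1 (hbelow i)
    _ = m + ε := by simp only [B]; field_simp

lemma norm_le_of_maximal_mul_deriv_right_nonpos [Fintype ι] {m : ℝ} (hf : ContinuousOn f (Icc a b))
    (hf' : ∀ t ∈ Ico a b, HasDerivWithinAt f (f' t) (Ici t) t) (ha : ‖f a‖ ≤ m)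
    (hmax : ∀ t ∈ Ico a b, ∀ i, m < |f t i| → (∀ j, |f t j| ≤ |f t i|) → f t i * f' t i ≤ 0)
    (hab : a ≤ b) : ‖f b‖ ≤ m := by
  have hm : 0 ≤ m := (norm_nonneg _).trans ha
  have hsq : ∀ c : ℝ, c ^ 2 ≤ m ^ 2 ↔ |c| ≤ m := fun c => by rw [sq_le_sq, abs_of_nonneg hm]
  have hder : ∀ t ∈ Ico a b, HasDerivWithinAt (fun t i => f t i ^ 2)
      (fun i => 2 * (f t i * f' t i)) (Ici t) t := fun t ht => hasDerivWithinAt_pi.2 fun i =>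
    ((hasDerivWithinAt_pi.1 (hf' t ht) i).fun_pow 2).congr_deriv (by norm_num [mul_assoc])
  refine (pi_norm_le_iff_of_nonneg hm).2 fun i => (hsq _).1 ?_
  refine le_of_maximal_deriv_right_nonpos (f := fun t i => f t i ^ 2) (by fun_prop) hder
    (fun j => (hsq _).2 ((norm_le_pi_norm _ j).trans ha)) (fun t ht j hj hle => ?_) hab i
  exact mul_nonpos_of_nonneg_of_nonpos zero_le_two
    (hmax t ht j (lt_of_not_ge (mt (hsq _).2 hj.not_ge)) fun k => sq_le_sq.1 (hle k))

end MaximumPrinciple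

lemma zero_mem_of_frequently_deriv_sub_mem {E : Type*} [NormedAddCommGroup E] [NormedSpace ℝ E]
    {x u g : ℝ → E} {p : E} {K : Set E} {δ : ℝ} (hKc : Convex ℝ K) (hK : IsClosed K) (hδ : 0 < δ)
    (hx : ∀ t, 0 ≤ t → HasDerivWithinAt x (u t) (Ici 0) t) (hp : Tendsto x atTop (𝓝 p))
    (hg : Tendsto g atTop (𝓝 0))
    (hstay : ∃ᶠ s in atTop, ∀ t ∈ Icc s (s + δ), u t - g t ∈ K) : (0 : E) ∈ K := by
  by_contra h0
  obtain ⟨φ, c, hc0, hc⟩ := geometric_hahn_banach_point_closed hKc hK h0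
  rw [map_zero] at hc0
  have hφx : Tendsto (fun t => φ (x t)) atTop (𝓝 (φ p)) := (φ.continuous.tendsto p).comp hp
  have hslope : Tendsto (fun s => (φ (x (s + δ)) - φ (x s)) / (s + δ - s)) atTop (𝓝 0) := by
    simpa using ((hφx.comp (tendsto_atTop_add_const_right _ δ tendsto_id)).sub hφx).div_const δ
  have hφg : Tendsto (fun t => φ (g t)) atTop (𝓝 0) := by
    simpa only [map_zero, Function.comp_def] using (φ.continuous.tendsto 0).comp hg
  have hlate : ∀ᶠ s in atTop, 0 ≤ s ∧ ∀ t, s ≤ t → -(c / 2) < φ (g t) :=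
    (eventually_ge_atTop 0).and
      (eventually_forall_ge_atTop.2 (hφg.eventually_const_lt (neg_neg_of_pos (half_pos hc0))))
  obtain ⟨s, hsK, ⟨hs0, hsg⟩, hsc⟩ :=
    (hstay.and_eventually (hlate.and (hslope.eventually_lt_const (half_pos hc0)))).exists
  have hφ' : ∀ t, 0 ≤ t → HasDerivWithinAt (fun t => φ (x t)) (φ (u t)) (Ici 0) t := fun t ht =>
    φ.hasFDerivAt.comp_hasDerivWithinAt t (hx t ht)
  obtain ⟨t, ht, hmean⟩ := exists_hasDerivAt_eq_slope (fun t => φ (x t)) (fun t => φ (u t))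
    (lt_add_of_pos_right s hδ)
    (fun t ht => (hφ' t (hs0.trans ht.1)).continuousWithinAt.mono fun r hr => hs0.trans hr.1)
    (fun t ht => (hφ' t (hs0.trans ht.1.le)).hasDerivAt (Ici_mem_nhds (hs0.trans_lt ht.1)))
  have hsep := hc _ (hsK t (Ioo_subset_Icc_self ht))
  rw [map_sub, hmean] at hsep
  linarith [hsg t ht.1.le]

lemma sq_norm_le_inner_of_isMinOn_norm {F : Type*} [NormedAddCommGroup F] [InnerProductSpace ℝ F]
    {K : Set F} (hK : Convex ℝ K) {u v : F} (hu : u ∈ K) (hmin : IsMinOn (‖·‖) K u) (hv : v ∈ K) :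
    ‖u‖ ^ 2 ≤ inner ℝ u v := by
  have hdist : ‖0 - u‖ = ⨅ w : K, ‖0 - (w : F)‖ := by
    simpa only [zero_sub, norm_neg] using (hmin.iInf_eq hu).symm
  have hinner := (norm_eq_iInf_iff_real_inner_le_zero hK hu).1 hdist v hv
  rw [zero_sub, inner_neg_left, inner_sub_right, real_inner_self_eq_norm_sq] at hinner
  linarith

end Analysis

section Laplacian

variable {V : Type*} [Fintype V] (G : SimpleGraph V) [DecidableRel G.Adj]

/-- The vector of total deviations `∑ j ∈ N i, (x j - x i)` of the neighbors' states from the state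
of `i`, i.e. minus the graph Laplacian applied to `x`. -/
def deviation (x : V → ℝ) : V → ℝ :=
  fun i => ∑ j ∈ G.neighborFinset i, (x j - x i)

/-- The Dirichlet energy `∑ (x j - x i) ^ 2`, summed over the edges; it is the Lyapunov function of
the dynamics. The definition is the form that the sum takes after summation by parts. -/
def dirichletEnergy (x : V → ℝ) : ℝ :=
  -∑ i, x i * deviation G x i

lemma continuous_deviation : Continuous (deviation G) := by
  unfold deviation
  fun_prop

lemma continuous_dirichletEnergy : Continuous (dirichletEnergy G) := by
  have := continuous_deviation G
  unfold dirichletEnergy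
  fun_prop

lemma deviation_zero : deviation G 0 = 0 := by
  ext i
  simp [deviation]

lemma deviation_sub (x y : V → ℝ) : deviation G (x - y) = deviation G x - deviation G y := by
  ext i
  simp only [deviation, Pi.sub_apply, ← Finset.sum_sub_distrib]
  exact Finset.sum_congr rfl fun j _ => by ring

lemma deviation_apply (x : V → ℝ) (i : V) :
    deviation G x i = ∑ j ∈ G.neighborFinset i, x j - G.degree i * x i := by
  rw [deviation, Finset.sum_sub_distrib, Finset.sum_const, nsmul_eq_mul,
    SimpleGraph.card_neighborFinset_eq_degree]

lemma sum_mul_deviation_comm (x y : V → ℝ) :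
    ∑ i, x i * deviation G y i = ∑ i, y i * deviation G x i := by
  have hswap : ∑ i, ∑ j ∈ G.neighborFinset i, x i * y j
      = ∑ i, ∑ j ∈ G.neighborFinset i, x j * y i :=
    Finset.sum_comm' (by simp [SimpleGraph.adj_comm])
  simp only [deviation_apply, mul_sub, Finset.mul_sum, Finset.sum_sub_distrib, hswap]
  simp only [mul_comm, mul_left_comm]

lemma mul_deviation_nonpos_of_forall_abs_le {x : V → ℝ} {i : V} (hi : ∀ j, |x j| ≤ |x i|) :
    x i * deviation G x i ≤ 0 := by
  rw [deviation, Finset.mul_sum]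
  refine Finset.sum_nonpos fun j _ => ?_
  have : x i * x j ≤ x i * x i := calc
    x i * x j ≤ |x i| * |x j| := (le_abs_self _).trans_eq (abs_mul _ _)
    _ ≤ |x i| * |x i| := mul_le_mul_of_nonneg_left (hi j) (abs_nonneg _)
    _ = x i * x i := abs_mul_abs_self _
  rw [mul_sub]
  exact sub_nonpos.2 this

variable {x : ℝ → V → ℝ} {x' : V → ℝ} {S : Set ℝ} {t : ℝ}

lemma hasDerivWithinAt_deviation (hx : HasDerivWithinAt x x' S t) :
    HasDerivWithinAt (fun s => deviation G (x s)) (deviation G x') S t := by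
  rw [hasDerivWithinAt_pi] at hx ⊢
  exact fun i => .fun_sum fun j _ => (hx j).sub (hx i)

lemma hasDerivWithinAt_dirichletEnergy (hx : HasDerivWithinAt x x' S t) :
    HasDerivWithinAt (fun s => dirichletEnergy G (x s)) (-2 * ∑ i, x' i * deviation G (x t) i)
      S t := by
  have hdev := hasDerivWithinAt_deviation G hx
  rw [hasDerivWithinAt_pi] at hx hdev
  refine HasDerivWithinAt.fun_neg
    (HasDerivWithinAt.fun_sum fun i _ => (hx i).mul (hdev i)) |>.congr_deriv ?_
  rw [Finset.sum_add_distrib, sum_mul_deviation_comm G (x t)]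
  ring

end Laplacian

section DampedFlow

variable {V : Type*} [Fintype V] {G : SimpleGraph V} [DecidableRel G.Adj]

/-- `x` moves with a velocity `u` each component of which has the sign of the corresponding total
deviation and does not exceed it in modulus; `u i ^ 2 ≤ u i * deviation G x i` encodes both
conditions. This is all that convergence needs to know about the lazy protocol. -/
structure IsDampedFlow (G : SimpleGraph V) [DecidableRel G.Adj] (x u : ℝ → V → ℝ) : Prop where
  hasDerivWithinAt : ∀ t, 0 ≤ t → HasDerivWithinAt x (u t) (Ici 0) t
  sq_le : ∀ t, 0 ≤ t → ∀ i, u t i ^ 2 ≤ u t i * deviation G (x t) i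

lemma mul_nonpos_of_sq_le_mul {a u ℓ : ℝ} (hu : u ^ 2 ≤ u * ℓ) (ha : a * ℓ ≤ 0) : a * u ≤ 0 := by
  by_contra! hau
  have hu0 : 0 < u ^ 2 := sq_pos_of_ne_zero (right_ne_zero_of_mul hau.ne')
  have : 0 < (a * u) * (u * ℓ) := mul_pos hau (hu0.trans_le hu)
  nlinarith [mul_nonpos_of_nonneg_of_nonpos hu0.le ha]

namespace IsDampedFlow

variable {x u : ℝ → V → ℝ} {p : V → ℝ} {s t : ℝ}

lemma continuousOn (h : IsDampedFlow G x u) : ContinuousOn x (Ici 0) :=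
  fun t ht => (h.hasDerivWithinAt t ht).continuousWithinAt

lemma mul_deviation_nonneg (h : IsDampedFlow G x u) (ht : 0 ≤ t) (i : V) :
    0 ≤ u t i * deviation G (x t) i :=
  (sq_nonneg _).trans (h.sq_le t ht i)

lemma norm_sub_le (h : IsDampedFlow G x u) (hs : 0 ≤ s) (hst : s ≤ t) {m : ℝ}
    (hm : ‖x s - p‖ ≤ m)
    (hboundary : ∀ r ∈ Ico s t, ∀ i, deviation G p i ≠ 0 → |x r i - p i| ≤ m) :
    ‖x t - p‖ ≤ m := by
  have hsub : Icc s t ⊆ Ici 0 := fun r hr => hs.trans hr.1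
  refine norm_le_of_maximal_mul_deriv_right_nonpos (f := fun r => x r - p) (f' := u)
    ((h.continuousOn.mono hsub).sub continuousOn_const)
    (fun r hr => ((h.hasDerivWithinAt r (hs.trans hr.1)).sub_const p).mono
      (Ici_subset_Ici.2 (hs.trans hr.1))) hm (fun r hr i hi hmax => ?_) hst
  have hp : deviation G p i = 0 := by
    by_contra hne
    exact (hboundary r hr i hne).not_gt hi
  have hdev : deviation G (x r - p) i = deviation G (x r) i := by
    rw [deviation_sub, Pi.sub_apply, hp, sub_zero]
  exact mul_nonpos_of_sq_le_mul (h.sq_le r (hs.trans hr.1) i)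
    (hdev ▸ mul_deviation_nonpos_of_forall_abs_le G hmax)

lemma exists_mapClusterPt (h : IsDampedFlow G x u) : ∃ p, MapClusterPt p atTop x := by
  have hbounded : ∀ᶠ t in atTop, x t ∈ Metric.closedBall 0 ‖x 0‖ := by
    filter_upwards [eventually_ge_atTop 0] with t ht
    rw [mem_closedBall_zero_iff, ← sub_zero (x t)]
    exact h.norm_sub_le le_rfl ht (by rw [sub_zero]) fun r _ i hi =>
      absurd (congrFun (deviation_zero G) i) hi
  obtain ⟨p, -, hp⟩ := (isCompact_closedBall (0 : V → ℝ) ‖x 0‖).exists_mapClusterPt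
    (tendsto_principal.2 hbounded)
  exact ⟨p, hp⟩

lemma mul_abs_sub_le (h : IsDampedFlow G x u) (hs : 0 ≤ s) (hst : s ≤ t) {ℓ : ℝ} (hℓ : 0 ≤ ℓ)
    {i : V} (hi : ∀ r ∈ Ico s t, ℓ ≤ |deviation G (x r) i|) :
    2 * ℓ * |x t i - x s i| ≤ dirichletEnergy G (x s) - dirichletEnergy G (x t) := by
  have hsub : Icc s t ⊆ Ici 0 := fun r hr => hs.trans hr.1
  have hx : ∀ r, 0 ≤ r → HasDerivWithinAt (fun r => 2 * ℓ * (x r i - x s i)) (2 * ℓ * u r i)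
      (Ici 0) r := fun r hr =>
    ((hasDerivWithinAt_pi.1 (h.hasDerivWithinAt r hr) i).sub_const _).const_mul _
  have hE : ∀ r, 0 ≤ r → HasDerivWithinAt
      (fun r => dirichletEnergy G (x s) - dirichletEnergy G (x r))
      (2 * ∑ j, u r j * deviation G (x r) j) (Ici 0) r := fun r hr =>
    ((hasDerivWithinAt_dirichletEnergy G (h.hasDerivWithinAt r hr)).const_sub _).congr_deriv
      (by ring)
  have hbound : ∀ r ∈ Ico s t, ‖2 * ℓ * u r i‖ ≤ 2 * ∑ j, u r j * deviation G (x r) j := by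
    intro r hr
    have hr0 := hs.trans hr.1
    calc ‖2 * ℓ * u r i‖ = 2 * (|u r i| * ℓ) := by
          rw [Real.norm_eq_abs, abs_mul, abs_of_nonneg (by positivity)]; ring
      _ ≤ 2 * (|u r i| * |deviation G (x r) i|) := by gcongr; exact hi r hr
      _ = 2 * (u r i * deviation G (x r) i) := by
          rw [← abs_mul, abs_of_nonneg (h.mul_deviation_nonneg hr0 i)]
      _ ≤ 2 * ∑ j, u r j * deviation G (x r) j := by
          gcongr
          exact Finset.single_le_sum (f := fun j => u r j * deviation G (x r) j)
            (fun j _ => h.mul_deviation_nonneg hr0 j) (Finset.mem_univ i)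
  have hnorm := image_norm_le_of_norm_deriv_right_le_deriv_boundary'
    (fun r hr => (hx r (hsub hr)).continuousWithinAt.mono hsub)
    (fun r hr => (hx r (hs.trans hr.1)).mono (Ici_subset_Ici.2 (hs.trans hr.1))) (by simp)
    (fun r hr => (hE r (hsub hr)).continuousWithinAt.mono hsub)
    (fun r hr => (hE r (hs.trans hr.1)).mono (Ici_subset_Ici.2 (hs.trans hr.1))) hbound
    (right_mem_Icc.2 hst)
  rwa [Real.norm_eq_abs, abs_mul, abs_of_nonneg (by positivity)] at hnorm

lemma antitoneOn_dirichletEnergy (h : IsDampedFlow G x u) :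
    AntitoneOn (fun t => dirichletEnergy G (x t)) (Ici 0) := by
  have hE : ∀ t, 0 ≤ t → HasDerivWithinAt (fun t => dirichletEnergy G (x t))
      (-2 * ∑ i, u t i * deviation G (x t) i) (Ici 0) t := fun t ht =>
    hasDerivWithinAt_dirichletEnergy G (h.hasDerivWithinAt t ht)
  refine antitoneOn_of_hasDerivWithinAt_nonpos (convex_Ici 0)
    (fun t ht => (hE t ht).continuousWithinAt)
    (fun t ht => (hE t (interior_subset ht)).mono interior_subset) (fun t ht => ?_)
  exact mul_nonpos_of_nonpos_of_nonneg (by norm_num)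
    (Finset.sum_nonneg fun i _ => h.mul_deviation_nonneg (interior_subset ht) i)

lemma dirichletEnergy_le_of_mapClusterPt (h : IsDampedFlow G x u)
    (hp : MapClusterPt p atTop x) (hs : 0 ≤ s) : dirichletEnergy G p ≤ dirichletEnergy G (x s) := by
  by_contra! hlt
  obtain ⟨t, ht, hst⟩ := ((hp.frequently
    ((continuous_dirichletEnergy G).continuousAt.eventually_const_lt hlt)).and_eventually
      (eventually_ge_atTop s)).exists
  exact (h.antitoneOn_dirichletEnergy hs (hs.trans hst) hst).not_gt ht

lemma norm_sub_lt_of_forall_half_le (h : IsDampedFlow G x u) (hp : MapClusterPt p atTop x) {R : ℝ}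
    (hR : 0 < R)
    (hhalf : ∀ y, ‖y - p‖ < R → ∀ i, |deviation G p i| / 2 ≤ |deviation G y i|) (hs : 0 ≤ s)
    (hxs : ‖x s - p‖ < R / 3)
    (hEs : ∀ i, deviation G p i ≠ 0 →
      dirichletEnergy G (x s) - dirichletEnergy G p ≤ |deviation G p i| * (R / 3))
    (hst : s ≤ t) : ‖x t - p‖ < R := by
  have hcont : ContinuousOn (fun r => ‖x r - p‖) (Icc s t) :=
    ((h.continuousOn.mono fun r hr => hs.trans hr.1).sub continuousOn_const).norm
  refine lt_of_forall_Ico_lt hcont (fun τ hτ hlt => ?_) (right_mem_Icc.2 hst)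
  suffices ‖x τ - p‖ ≤ R / 3 + R / 3 by linarith
  refine h.norm_sub_le hs hτ.1 (by linarith) fun r hr i hi => ?_
  have hmove : |deviation G p i| * |x r i - x s i| ≤ |deviation G p i| * (R / 3) := calc
    |deviation G p i| * |x r i - x s i|
      = 2 * (|deviation G p i| / 2) * |x r i - x s i| := by ring
    _ ≤ dirichletEnergy G (x s) - dirichletEnergy G (x r) :=
        h.mul_abs_sub_le hs hr.1 (by positivity) fun r' hr' =>
          hhalf _ (hlt r' ⟨hr'.1, hr'.2.trans hr.2⟩) i
    _ ≤ dirichletEnergy G (x s) - dirichletEnergy G p :=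
        sub_le_sub_left (h.dirichletEnergy_le_of_mapClusterPt hp (hs.trans hr.1)) _
    _ ≤ |deviation G p i| * (R / 3) := hEs i hi
  calc |x r i - p i| ≤ |x r i - x s i| + |x s i - p i| := abs_sub_le _ _ _
    _ ≤ R / 3 + R / 3 := add_le_add (le_of_mul_le_mul_left hmove (abs_pos.2 hi))
        ((norm_le_pi_norm (x s - p) i).trans hxs.le)

lemma tendsto_of_mapClusterPt (h : IsDampedFlow G x u) (hp : MapClusterPt p atTop x) :
    Tendsto x atTop (𝓝 p) := by
  have hhalf : ∀ᶠ y in 𝓝 p, ∀ i, |deviation G p i| / 2 ≤ |deviation G y i| := by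
    refine eventually_all.2 fun i => ?_
    rcases eq_or_ne (deviation G p i) 0 with hi | hi
    · simp [hi]
    · have hcont : Continuous fun y => |deviation G y i| :=
        (continuous_pi_iff.1 (continuous_deviation G) i).abs
      exact (hcont.continuousAt.eventually_const_lt (half_lt_self (abs_pos.2 hi))).mono
        fun _ => le_of_lt
  obtain ⟨ρ, hρ, hball⟩ := Metric.eventually_nhds_iff.1 hhalf
  refine Metric.tendsto_atTop.2 fun ε hε => ?_
  have hR : 0 < min ρ ε := lt_min hρ hε
  have hsmall : ∀ᶠ y in 𝓝 p, ∀ i, deviation G p i ≠ 0 →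
      dirichletEnergy G y - dirichletEnergy G p ≤ |deviation G p i| * (min ρ ε / 3) := by
    refine eventually_all.2 fun i => eventually_imp_distrib_left.2 fun hi => ?_
    have hcont : Continuous fun y => dirichletEnergy G y - dirichletEnergy G p :=
      (continuous_dirichletEnergy G).sub continuous_const
    refine (hcont.continuousAt.eventually_lt_const ?_).mono fun _ => le_of_lt
    simp only [sub_self]
    positivity
  have hnear : ∀ᶠ y in 𝓝 p, y ∈ Metric.ball p (min ρ ε / 3) :=
    Metric.ball_mem_nhds p (div_pos hR three_pos)
  obtain ⟨s, ⟨hxs, hEs⟩, hs⟩ :=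
    ((hp.frequently (hnear.and hsmall)).and_eventually (eventually_ge_atTop 0)).exists
  refine ⟨s, fun t ht => ?_⟩
  rw [dist_eq_norm]
  exact (h.norm_sub_lt_of_forall_half_le hp hR
    (fun y hy => hball ((dist_eq_norm y p).trans_lt (hy.trans_le (min_le_left ρ ε)))) hs
    (mem_ball_iff_norm.1 hxs) hEs ht).trans_le (min_le_right ρ ε)

lemma exists_tendsto (h : IsDampedFlow G x u) : ∃ p, Tendsto x atTop (𝓝 p) :=
  let ⟨p, hp⟩ := h.exists_mapClusterPt
  ⟨p, h.tendsto_of_mapClusterPt hp⟩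

end IsDampedFlow

end DampedFlow

section Control

variable {V : Type*} [Fintype V] {G : SimpleGraph V} [DecidableRel G.Adj] {ξ u : ℝ} {i : V}
  {d : V → V → ℝ} {x : V → ℝ}

lemma abs_sum_neighborFinset_le {w : V → ℝ} (hw : ∀ j ∈ G.neighborFinset i, |w j| ≤ ξ) :
    |∑ j ∈ G.neighborFinset i, w j| ≤ G.degree i * ξ := by
  rw [← SimpleGraph.card_neighborFinset_eq_degree, ← nsmul_eq_mul]
  exact (Finset.abs_sum_le_sum_abs _ _).trans (Finset.sum_le_card_nsmul _ _ _ hw)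

lemma image_sum_estimates (xi : ℝ) (y : V → ℝ) :
    (fun z : V → ℝ => ∑ j ∈ G.neighborFinset i, (z j - xi)) '' estimates G ξ i y
      = Metric.closedBall (∑ j ∈ G.neighborFinset i, (y j - xi)) (G.degree i * ξ) := by
  ext v
  rw [Metric.mem_closedBall, Real.dist_eq]
  constructor
  · rintro ⟨z, hz, rfl⟩
    rw [← Finset.sum_sub_distrib]
    refine abs_sum_neighborFinset_le fun j hj => ?_
    rw [sub_sub_sub_cancel_right, abs_sub_le_iff, sub_le_iff_le_add', sub_le_comm]
    exact ⟨(hz j hj).2, (hz j hj).1⟩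
  · intro hv
    set c := ∑ j ∈ G.neighborFinset i, (y j - xi)
    refine ⟨fun j => y j + (v - c) / G.degree i, fun j hj => ?_, ?_⟩
    · have hn : (0 : ℝ) < G.degree i :=
        Nat.cast_pos.2 ((G.degree_pos_iff_exists_adj i).2 ⟨j, (G.mem_neighborFinset i j).1 hj⟩)
      have hshift : |(v - c) / G.degree i| ≤ ξ := by
        rwa [abs_div, abs_of_pos hn, div_le_iff₀' hn]
      rw [sub_eq_add_neg]
      exact ⟨add_le_add_right (neg_le_of_abs_le hshift) _,
        add_le_add_right (le_of_abs_le hshift) _⟩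
    · have hisolated : (G.degree i : ℝ) = 0 → v - c = 0 := fun h0 =>
        abs_nonpos_iff.1 (by simpa only [h0, zero_mul] using hv)
      calc ∑ j ∈ G.neighborFinset i, (y j + (v - c) / G.degree i - xi)
          = c + G.degree i * ((v - c) / G.degree i) := by
            simp only [add_sub_right_comm _ _ xi, Finset.sum_add_distrib, Finset.sum_const,
              nsmul_eq_mul, SimpleGraph.card_neighborFinset_eq_degree, c]
        _ = v := by rw [mul_div_cancel_of_imp' hisolated, add_sub_cancel]

lemma isControl_iff {xi : ℝ} {y : V → ℝ} :
    IsControl G ξ i xi y u ↔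
      u ∈ Metric.closedBall (∑ j ∈ G.neighborFinset i, (y j - xi)) (G.degree i * ξ) ∧
      IsMinOn (‖·‖) (Metric.closedBall (∑ j ∈ G.neighborFinset i, (y j - xi)) (G.degree i * ξ))
        u := by
  rw [← image_sum_estimates]
  constructor
  · rintro ⟨z, ⟨hz, hmin⟩, rfl⟩
    exact ⟨mem_image_of_mem _ hz, forall_mem_image.2 hmin⟩
  · rintro ⟨⟨z, hz, rfl⟩, hmin⟩
    exact ⟨z, ⟨hz, fun w hw => hmin (mem_image_of_mem _ hw)⟩, rfl⟩

lemma sum_information (d : V → V → ℝ) (x : V → ℝ) (i : V) :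
    ∑ j ∈ G.neighborFinset i, (information G d x i j - x i)
      = deviation G x i + ∑ j ∈ G.neighborFinset i, d i j := by
  rw [deviation, ← Finset.sum_add_distrib]
  refine Finset.sum_congr rfl fun j hj => ?_
  rw [information, if_pos ((G.mem_neighborFinset i j).1 hj)]
  ring

lemma IsControl.abs_sub_le (h : IsControl G ξ i (x i) (information G d x i) u) :
    |u - (deviation G x i + ∑ j ∈ G.neighborFinset i, d i j)| ≤ G.degree i * ξ := by
  rw [← sum_information]
  exact (isControl_iff.1 h).1

lemma IsControl.sq_le_mul_deviation (hd : d ∈ cube V ξ)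
    (h : IsControl G ξ i (x i) (information G d x i) u) : u ^ 2 ≤ u * deviation G x i := by
  obtain ⟨hu, hmin⟩ := isControl_iff.1 h
  have hdev : deviation G x i ∈ Metric.closedBall
      (∑ j ∈ G.neighborFinset i, (information G d x i j - x i)) (G.degree i * ξ) := by
    rw [sum_information, Metric.mem_closedBall, dist_self_add_right]
    exact abs_sum_neighborFinset_le fun j _ => abs_le.2 (hd i j)
  have hinner := sq_norm_le_inner_of_isMinOn_norm (convex_closedBall _ _) hu hmin hdev
  rwa [Real.norm_eq_abs, sq_abs, real_inner_comm] at hinner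

lemma isControl_zero_iff :
    IsControl G ξ i (x i) (information G d x i) 0 ↔
      |deviation G x i + ∑ j ∈ G.neighborFinset i, d i j| ≤ G.degree i * ξ := by
  have hmin : ∀ s : Set ℝ, IsMinOn (‖·‖) s 0 := fun s v _ => by simp
  rw [isControl_iff, and_iff_left (hmin _), sum_information, Metric.mem_closedBall, dist_zero_left,
    Real.norm_eq_abs]

end Control

section Limit

open scoped Pointwise

variable {V : Type*}

lemma cube_eq_Icc (ξ : ℝ) : cube V ξ = Icc (fun _ _ => -ξ) (fun _ _ => ξ) := by
  ext d
  simp only [cube, mem_ofPred_eq, mem_Icc, Pi.le_def, forall_and]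

lemma isCompact_cube (ξ : ℝ) : IsCompact (cube V ξ) :=
  cube_eq_Icc (V := V) ξ ▸ isCompact_Icc

lemma convex_cube (ξ : ℝ) : Convex ℝ (cube V ξ) :=
  cube_eq_Icc (V := V) ξ ▸ convex_Icc _ _

lemma isClosed_box (ξ : ℝ) (dlo dhi : V → V → ℝ) : IsClosed (box ξ dlo dhi) :=
  (isCompact_cube ξ).isClosed.inter isClosed_Icc

lemma convex_box (ξ : ℝ) (dlo dhi : V → V → ℝ) : Convex ℝ (box ξ dlo dhi) :=
  (convex_cube ξ).inter (convex_Icc dlo dhi)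

lemma frequently_forall_mem_of_lt_longestStay {d : ℝ → V → V → ℝ} {Q : Set (V → V → ℝ)} {M δ : ℝ}
    (hδ : 0 < δ) (hμ : ∀ t, 0 ≤ t → δ < longestStay d Q t (t + M)) :
    ∃ᶠ s in atTop, ∀ t ∈ Icc s (s + δ), d t ∈ Q := by
  refine frequently_atTop.2 fun T => ?_
  obtain ⟨Δ, ⟨-, s, hs, -, hQ⟩, hΔ⟩ : ∃ Δ ∈ {Δ : ℝ | 0 ≤ Δ ∧ ∃ s, max T 0 ≤ s ∧
      s + Δ ≤ max T 0 + M ∧ ∀ t ∈ Icc s (s + Δ), d t ∈ Q}, δ < Δ := by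
    by_contra! hle
    exact (hμ _ (le_max_right T 0)).not_ge (Real.sSup_le hle hδ.le)
  exact ⟨s, (le_max_left T 0).trans hs, fun t ht => hQ t ⟨ht.1, ht.2.trans (by gcongr)⟩⟩

variable [Fintype V] (G : SimpleGraph V) [DecidableRel G.Adj]

/-- The velocities that compatible estimates, not necessarily lazy ones, can produce in the state
`p` under disturbances in `Q`. -/
def feasibleVelocities (ξ : ℝ) (Q : Set (V → V → ℝ)) (p : V → ℝ) : Set (V → ℝ) :=
  {v | ∃ q ∈ Q, ∀ i,
    |v i - (deviation G p i + ∑ j ∈ G.neighborFinset i, q i j)| ≤ G.degree i * ξ}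

variable {G} {ξ : ℝ} {Q : Set (V → V → ℝ)} {p : V → ℝ}

lemma feasibleVelocities_eq_add : feasibleVelocities G ξ Q p =
    (fun q i => ∑ j ∈ G.neighborFinset i, q i j) '' Q +
      univ.pi fun i => Metric.closedBall (deviation G p i) (G.degree i * ξ) := by
  ext v
  constructor
  · rintro ⟨q, hq, hv⟩
    refine ⟨_, mem_image_of_mem _ hq, v - fun i => ∑ j ∈ G.neighborFinset i, q i j, fun i _ => ?_,
      add_sub_cancel _ _⟩
    rw [Metric.mem_closedBall, Real.dist_eq, Pi.sub_apply, sub_sub, add_comm]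
    exact hv i
  · rintro ⟨_, ⟨q, hq, rfl⟩, w, hw, rfl⟩
    refine ⟨q, hq, fun i => ?_⟩
    simpa only [Pi.add_apply, add_comm (deviation G p i), add_sub_add_left_eq_sub, Real.norm_eq_abs]
      using mem_closedBall_iff_norm.1 (hw i (mem_univ i))

lemma sub_mem_feasibleVelocities {v y : V → ℝ} (hv : v ∈ feasibleVelocities G ξ Q y) :
    v - (deviation G y - deviation G p) ∈ feasibleVelocities G ξ Q p := by
  obtain ⟨q, hq, hv⟩ := hv
  refine ⟨q, hq, fun i => ?_⟩
  rw [Pi.sub_apply, Pi.sub_apply, sub_sub, ← add_assoc, sub_add_cancel]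
  exact hv i

lemma convex_feasibleVelocities (hQ : Convex ℝ Q) : Convex ℝ (feasibleVelocities G ξ Q p) := by
  rw [feasibleVelocities_eq_add]
  refine (hQ.is_linear_image ⟨fun q q' => ?_, fun c q => ?_⟩).add
    (convex_pi fun _ _ => convex_closedBall _ _)
  · ext i
    exact Finset.sum_add_distrib
  · ext i
    exact (Finset.mul_sum ..).symm

lemma isCompact_feasibleVelocities (hQ : IsCompact Q) :
    IsCompact (feasibleVelocities G ξ Q p) := by
  rw [feasibleVelocities_eq_add]
  exact (hQ.image (by fun_prop)).add (isCompact_univ_pi fun _ => isCompact_closedBall _ _)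

lemma isEquilibriumPoint_const_iff {q : V → V → ℝ} :
    IsEquilibriumPoint G ξ (fun _ => q) p ↔
      ∀ i, |deviation G p i + ∑ j ∈ G.neighborFinset i, q i j| ≤ G.degree i * ξ := by
  simp only [IsEquilibriumPoint, isControl_zero_iff]
  exact ⟨fun ⟨T, _, h⟩ => h T le_rfl, fun h => ⟨0, le_rfl, fun _ _ => h⟩⟩

lemma zero_mem_feasibleVelocities_iff :
    0 ∈ feasibleVelocities G ξ Q p ↔ ∃ q ∈ Q, IsEquilibriumPoint G ξ (fun _ => q) p := by
  simp only [feasibleVelocities, mem_ofPred_eq, Pi.zero_apply, zero_sub, abs_neg,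
    isEquilibriumPoint_const_iff]

lemma IsTrajectory.exists_isDampedFlow {d : ℝ → V → V → ℝ} {x : ℝ → V → ℝ}
    (hx : IsTrajectory G ξ d x) (hd : ∀ t, 0 ≤ t → d t ∈ cube V ξ) :
    ∃ u, IsDampedFlow G x u ∧
      ∀ t, 0 ≤ t → ∀ Q, d t ∈ Q → u t ∈ feasibleVelocities G ξ Q (x t) := by
  choose! u hu hder using hx
  exact ⟨u, ⟨fun t ht => hasDerivWithinAt_pi.2 (hder t ht),
    fun t ht i => (hu t ht i).sq_le_mul_deviation (hd t ht)⟩,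
    fun t ht Q hQ => ⟨d t, hQ, fun i => (hu t ht i).abs_sub_le⟩⟩

lemma mem_polyhedron_of_isEquilibriumPoint {dlo dhi q : V → V → ℝ}
    (hdeg : ∀ i, 0 < G.degree i) (hlo : dlo ≤ q) (hhi : q ≤ dhi)
    (h : IsEquilibriumPoint G ξ (fun _ => q) p) : p ∈ polyhedron G ξ dlo dhi := by
  intro i
  have hn : (0 : ℝ) < G.degree i := Nat.cast_pos.2 (hdeg i)
  have hlo : ∑ j ∈ G.neighborFinset i, dlo i j ≤ ∑ j ∈ G.neighborFinset i, q i j :=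
    Finset.sum_le_sum fun j _ => hlo i j
  have hhi : ∑ j ∈ G.neighborFinset i, q i j ≤ ∑ j ∈ G.neighborFinset i, dhi i j :=
    Finset.sum_le_sum fun j _ => hhi i j
  have hdev := abs_le.1 (isEquilibriumPoint_const_iff.1 h i)
  rw [deviation_apply] at hdev
  constructor <;> field_simp <;> linarith

end Limit

end Consensus

open Consensus in
theorem theorem2_general {V : Type*} [Fintype V] (G : SimpleGraph V) [DecidableRel G.Adj] {ξ : ℝ}
    {d : ℝ → V → V → ℝ} (hd : ∀ t, 0 ≤ t → d t ∈ cube V ξ)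
    {Q : Set (V → V → ℝ)} (hQconvex : Convex ℝ Q) (hQclosed : IsClosed Q)
    {δ : ℝ} (hδ : 0 < δ) (hstay : ∃ᶠ s in atTop, ∀ t ∈ Icc s (s + δ), d t ∈ Q)
    {x : ℝ → V → ℝ} (hx : IsTrajectory G ξ d x) :
    ∃ p, Tendsto x atTop (𝓝 p) ∧
      ∃ q ∈ Q ∩ cube V ξ, IsEquilibriumPoint G ξ (fun _ => q) p := by
  obtain ⟨u, hflow, hu⟩ := hx.exists_isDampedFlow hd
  obtain ⟨p, hp⟩ := hflow.exists_tendsto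
  have hdev : Tendsto (fun t => deviation G (x t) - deviation G p) atTop (𝓝 0) :=
    tendsto_sub_nhds_zero_iff.2 (((continuous_deviation G).tendsto p).comp hp)
  refine ⟨p, hp, zero_mem_feasibleVelocities_iff.1 ?_⟩
  refine zero_mem_of_frequently_deriv_sub_mem
    (convex_feasibleVelocities (hQconvex.inter (convex_cube ξ)))
    (isCompact_feasibleVelocities ((isCompact_cube ξ).inter_left hQclosed)).isClosed
    hδ hflow.hasDerivWithinAt hp hdev ?_
  refine (hstay.and_eventually (eventually_ge_atTop 0)).mono fun s ⟨hsQ, hs⟩ t ht => ?_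
  have ht0 : 0 ≤ t := hs.trans ht.1
  exact sub_mem_feasibleVelocities (hu t ht0 _ ⟨hsQ t ht, hd t ht0⟩)

theorem theorem2 {V : Type*} [Fintype V] [Nontrivial V]
    (G : SimpleGraph V) [DecidableRel G.Adj] (hG : G.Connected)
    (ξ : ℝ) (hξ : 0 < ξ)
    (d : ℝ → V → V → ℝ) (hd : Consensus.IsRealization ξ d)
    (dlo dhi : V → V → ℝ) (hlo : dlo ∈ Consensus.cube V ξ) (hhi : dhi ∈ Consensus.cube V ξ)
    (hle : dlo ≤ dhi)
    (M δ : ℝ) (hM : 0 ≤ M) (hδ : 0 < δ)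
    (hμ : ∀ t, 0 ≤ t → δ < Consensus.longestStay d (Consensus.box ξ dlo dhi) t (t + M))
    (x : ℝ → V → ℝ) (hx : Consensus.IsTrajectory G ξ d x) :
    ∃ p : V → ℝ, Tendsto x atTop (𝓝 p) ∧
      p ∈ Consensus.polyhedron G ξ dlo dhi ∧
      ∃ q ∈ Consensus.box ξ dlo dhi, Consensus.IsEquilibriumPoint G ξ (fun _ => q) p := by
  obtain ⟨p, hp, q, ⟨hq, -⟩, hpq⟩ := theorem2_general G hd.mem_cube
    (Consensus.convex_box ξ dlo dhi) (Consensus.isClosed_box ξ dlo dhi) hδ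
    (Consensus.frequently_forall_mem_of_lt_longestStay hδ hμ) hx
  exact ⟨p, hp, Consensus.mem_polyhedron_of_isEquilibriumPoint
    (fun i => hG.preconnected.degree_pos_of_nontrivial i) hq.2.1 hq.2.2 hpq, q, hq, hpq⟩
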